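/- Let $G$ be a second countable locally compact (Hausdorff) group. A compact $G$-space is a nonempty compact Hausdorff space $X$ with a (jointly) continuous action $G\times X\to X$; $\mathrm{Prob}(X)$ denotes the space of regular Borel probability measures on $X$ with the weak$^\ast$ topology. A $G$-boundary is a compact $G$-space $X$ that is minimal (every $G$-orbit is dense) and strongly proximal (for every $\mu\in\mathrm{Prob}(X)$, the closure of the orbit $G\mu$ in $\mathrm{Prob}(X)$ contains a Dirac measure). The action of $G$ on $X$ is topologically free if the set of points of $X$ with trivial stabilizer in $G$ is dense. A closed subgroup $H\le G$ is relatively amenable in $G$ if $H$ fixes a measure in $\mathrm{Prob}(X)$ for every compact $G$-space $X$, and it is confined if the closure of its conjugacy class $\{gHg^{-1} : g\in G\}$ in the Chabauty space $\mathrm{Sub}(G)$ of closed subgroups of $G$ does not contain the trivial subgroup $\{e\}$. Then there exists a $G$-boundary on which the $G$-action is topologically free if and only if no relatively amenable closed subgroup of $G$ is confined. -/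

import Mathlib

open Set MeasureTheory

universe u

/-- The Chabauty topology on the set `Sub(G)` of closed subgroups of `G`: the sets
`{L | L ∩ K = ∅}` (`K` compact) and `{L | L ∩ U ≠ ∅}` (`U` open) form a subbasis. -/
instance ClosedSubgroup.chabautyTopology (G : Type u) [Group G] [TopologicalSpace G] :
    TopologicalSpace (ClosedSubgroup G) :=
  TopologicalSpace.generateFrom
    ({S | ∃ K : Set G, IsCompact K ∧ S = {L : ClosedSubgroup G | (L : Set G) ∩ K = ∅}} ∪
     {S | ∃ U : Set G, IsOpen U ∧ S = {L : ClosedSubgroup G | ((L : Set G) ∩ U).Nonempty}})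

/-- The conjugate `g H g⁻¹` of a closed subgroup `H`. -/
def ClosedSubgroup.conj {G : Type u} [Group G] [TopologicalSpace G] [IsTopologicalGroup G]
    (g : G) (H : ClosedSubgroup G) : ClosedSubgroup G where
  toSubgroup := H.toSubgroup.map (MulAut.conj g).toMonoidHom
  isClosed' := by
    have h : IsClosed ((fun x : G => g⁻¹ * x * g) ⁻¹' (H.toSubgroup : Set G)) :=
      IsClosed.preimage (by fun_prop) H.isClosed'
    convert h using 1
    ext x
    change x ∈ H.toSubgroup.map (MulAut.conj g).toMonoidHom ↔ g⁻¹ * x * g ∈ H.toSubgroup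
    rw [Subgroup.mem_map]
    constructor
    · rintro ⟨y, hy, rfl⟩
      simpa [MulAut.conj_apply, mul_assoc] using hy
    · intro hx
      exact ⟨g⁻¹ * x * g, hx, by simp [MulAut.conj_apply, mul_assoc]⟩

/-- A closed subgroup is confined if the closure of its conjugacy class in `Sub(G)` does not
contain the trivial subgroup. -/
def ClosedSubgroup.IsConfined {G : Type u} [Group G] [TopologicalSpace G] [IsTopologicalGroup G]
    (H : ClosedSubgroup G) : Prop :=
  ∀ L ∈ closure (range fun g : G => H.conj g), L.toSubgroup ≠ ⊥

/-- `H` is relatively amenable in `G` if it fixes a (regular Borel) probability measure on every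
nonempty compact Hausdorff `G`-space. -/
def ClosedSubgroup.IsRelativelyAmenable {G : Type u} [Group G] [TopologicalSpace G]
    (H : ClosedSubgroup G) : Prop :=
  ∀ (X : Type u) [TopologicalSpace X] [CompactSpace X] [T2Space X] [Nonempty X]
    [MeasurableSpace X] [BorelSpace X] [MulAction G X] [ContinuousSMul G X],
    ∃ μ : Measure X, IsProbabilityMeasure μ ∧ μ.Regular ∧
      ∀ h ∈ H, μ.map (fun x : X => h • x) = μ

/-- The push-forward `g μ` of a Borel probability measure `μ` on a `G`-space by `g ∈ G`. -/
noncomputable def MeasureTheory.ProbabilityMeasure.translate {G X : Type u} [Group G]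
    [TopologicalSpace G] [TopologicalSpace X] [MeasurableSpace X] [BorelSpace X] [MulAction G X]
    [ContinuousSMul G X] (g : G) (μ : ProbabilityMeasure X) : ProbabilityMeasure X :=
  μ.map (f := fun x : X => g • x) (continuous_const_smul g).measurable.aemeasurable

/-- The action of `G` on `X` is strongly proximal if the orbit closure of every regular Borel
probability measure, in the topology of convergence against continuous functions (weak-*),
contains a Dirac measure. -/
def IsStronglyProximal (G X : Type u) [Group G] [TopologicalSpace G] [TopologicalSpace X]
    [MeasurableSpace X] [BorelSpace X] [MulAction G X] [ContinuousSMul G X] : Prop :=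
  ∀ μ : ProbabilityMeasure X, (μ : Measure X).Regular →
    ∃ x : X, diracProba x ∈ closure (range fun g : G => μ.translate g)

/-- A `G`-boundary: a nonempty compact Hausdorff `G`-space (with a jointly continuous action)
that is minimal and strongly proximal. -/
structure IsGBoundary (G X : Type u) [Group G] [TopologicalSpace G] [TopologicalSpace X]
    [MeasurableSpace X] [BorelSpace X] [MulAction G X] [ContinuousSMul G X] : Prop where
  nonempty : Nonempty X
  compact : CompactSpace X
  hausdorff : T2Space X
  minimal : MulAction.IsMinimal G X
  stronglyProximal : IsStronglyProximal G X

/-- The action is topologically free if the points with trivial stabilizer are dense. -/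
def IsTopologicallyFree (G X : Type u) [Group G] [TopologicalSpace X] [MulAction G X] : Prop :=
  Dense {x : X | MulAction.stabilizer G x = ⊥}

open Filter Topology

/-! A closed subgroup is not confined exactly when each compact set missing `1` is missed by some
conjugate (`ClosedSubgroup.isConfined_iff`).

If `H` fixes `μ` on a boundary, translates `g μ` converge to the Dirac mass at a point `y` with
trivial stabilizer. Were `H` confined, each `g H g⁻¹` would have an element `k g` in a fixed compact
set missing `1`. As `k g` fixes `g μ`, a limit of the `k g` fixes `y`, so it is `1`: a
contradiction.

Conversely, let `G` act on the states of the bounded functions with norm continuous left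
translation, take a minimal closed convex invariant set `Q` of states, and let `X` be the orbit
closure of an extreme point `e`. Minimality of `Q` and Milman's theorem put `e` in every orbit
closure in `Q`, so `X` is minimal. For `μ` on `X`, translates of its barycenter accumulate at `e`;
the limiting state on `C(X, ℝ)` has extreme barycenter, hence is a point evaluation, so `X` is
strongly proximal. A point stabilizer in `X` fixes a state, hence is relatively amenable, hence by
hypothesis is not confined. Minimality and Baire's theorem turn this into topological freeness. -/

theorem exists_ultrafilter_tendsto {ι Y : Type*} [TopologicalSpace Y] {f : ι → Y} {y : Y}
    (h : y ∈ closure (range f)) : ∃ l : Ultrafilter ι, Tendsto f l (𝓝 y) := by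
  have : NeBot (comap f (𝓝 y)) := comap_neBot_iff.2 fun t ht => by
    obtain ⟨_, hz, i, rfl⟩ := mem_closure_iff_nhds.1 h t ht
    exact ⟨i, hz⟩
  exact ⟨Ultrafilter.of _, tendsto_comap.mono_left (Ultrafilter.of_le _)⟩

/-! ### Confined subgroups through compact sets -/

section Chabauty

variable {G : Type u} [Group G] [TopologicalSpace G] [IsTopologicalGroup G]

theorem ClosedSubgroup.mem_conj_iff {H : ClosedSubgroup G} {g x : G} :
    x ∈ (H.conj g : Set G) ↔ g⁻¹ * x * g ∈ H := by
  change x ∈ H.toSubgroup.map (MulAut.conj g).toMonoidHom ↔ g⁻¹ * x * g ∈ H.toSubgroup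
  rw [Subgroup.mem_map]
  constructor
  · rintro ⟨y, hy, rfl⟩
    simpa [MulAut.conj_apply, mul_assoc] using hy
  · intro hx
    exact ⟨g⁻¹ * x * g, hx, by simp [MulAut.conj_apply, mul_assoc]⟩

/-- A closed subgroup is confined if and only if some compact set that misses the identity meets
all its conjugates. -/
theorem ClosedSubgroup.isConfined_iff [T2Space G] {H : ClosedSubgroup G} :
    H.IsConfined ↔ ∃ K : Set G, IsCompact K ∧ (1 : G) ∉ K ∧
      ∀ g, ((H.conj g : Set G) ∩ K).Nonempty := by
  constructor
  · contrapose!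
    intro h hconf
    let B : ClosedSubgroup G := ⟨⊥, isClosed_singleton⟩
    let I := {K : Set G // IsCompact K ∧ (1 : G) ∉ K}
    let s : I → Set G := fun K => {g | (H.conj g : Set G) ∩ K.1 = ∅}
    have : Nonempty I := ⟨⟨∅, isCompact_empty, by simp⟩⟩
    -- A conjugate missing `K ∪ L` misses both, so the sets `s K` generate a proper filter. Along it
    -- the conjugates tend to the trivial subgroup: conditions from open sets are automatic, since
    -- every subgroup contains `1`.
    have : NeBot (⨅ K : I, 𝓟 (s K)) := by
      refine iInf_neBot_of_directed (fun K L => ?_) fun K => ?_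
      · refine ⟨⟨K.1 ∪ L.1, K.2.1.union L.2.1, by simp [K.2.2, L.2.2]⟩, ?_, ?_⟩ <;>
        · simp only [ge_iff_le, le_principal_iff, mem_principal, s, inter_union_distrib_left,
            union_empty_iff]
          intro g hg
          simp_all
      · obtain ⟨g, hg⟩ := h K.1 K.2.1 K.2.2
        exact principal_neBot_iff.2 ⟨g, hg⟩
    have ht : Tendsto (fun g => H.conj g) (⨅ K : I, 𝓟 (s K)) (𝓝 B) := by
      refine TopologicalSpace.tendsto_nhds_generateFrom_iff.2 ?_
      rintro S (⟨K, hK, rfl⟩ | ⟨U, hU, rfl⟩) hB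
      · have h1 : (1 : G) ∉ K := fun h1 => by
          have : (1 : G) ∈ (B : Set G) ∩ K := ⟨B.toSubgroup.one_mem, h1⟩
          rw [mem_ofPred_eq] at hB
          simp [hB] at this
        exact mem_iInf_of_mem (⟨K, hK, h1⟩ : I) (by simp [s])
      · obtain ⟨x, hx, hxU⟩ := hB
        obtain rfl : x = 1 := Subgroup.mem_bot.1 hx
        exact univ_mem' fun g => ⟨1, (H.conj g).toSubgroup.one_mem, hxU⟩
    exact hconf B (mem_closure_of_tendsto ht (Eventually.of_forall fun g => ⟨g, rfl⟩)) rfl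
  · rintro ⟨K, hK, h1, h⟩ L hL hbot
    have hopen : IsOpen {L : ClosedSubgroup G | (L : Set G) ∩ K = ∅} :=
      TopologicalSpace.isOpen_generateFrom_of_mem (Or.inl ⟨K, hK, rfl⟩)
    have hLK : (L : Set G) ∩ K = ∅ := by
      rw [eq_empty_iff_forall_notMem]
      rintro x ⟨hx, hxK⟩
      have hx' : x ∈ L.toSubgroup := hx
      rw [hbot, Subgroup.mem_bot] at hx'
      exact h1 (hx' ▸ hxK)
    obtain ⟨_, hg, g, rfl⟩ := mem_closure_iff.1 hL _ hopen hLK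
    exact (h g).ne_empty hg

end Chabauty

/-! ### A topologically free boundary excludes confined relatively amenable subgroups -/

section Free

variable {G X : Type u} [Group G] [TopologicalSpace G] [TopologicalSpace X] [MeasurableSpace X]
  [BorelSpace X] [MulAction G X] [ContinuousSMul G X]

/-- The points whose Dirac masses lie in the orbit closure form a closed invariant set, nonempty by
strong proximality; minimality makes it everything. -/
theorem IsGBoundary.diracProba_mem_closure (hX : IsGBoundary G X) {μ : ProbabilityMeasure X}
    (hμ : (μ : Measure X).Regular) (y : X) :
    diracProba y ∈ closure (range fun g : G => μ.translate g) := by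
  obtain ⟨x, hx⟩ := hX.stronglyProximal μ hμ
  have hcl : IsClosed {z : X | diracProba z ∈ closure (range fun g : G => μ.translate g)} :=
    isClosed_closure.preimage continuous_diracProba
  have := hX.minimal
  refine closure_minimal ?_ hcl (MulAction.dense_orbit G x y)
  rintro _ ⟨g, rfl⟩
  have hmap : ∀ ν : ProbabilityMeasure X, ν.translate g =
      ν.map (f := fun x : X => g • x) (continuous_const_smul g).measurable.aemeasurable :=
    fun _ => rfl
  have hcont : Continuous fun ν : ProbabilityMeasure X => ν.translate g :=
    ProbabilityMeasure.continuous_map (continuous_const_smul g)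
  have h1 : diracProba (g • x) = (diracProba x).translate g := by
    apply ProbabilityMeasure.toMeasure_injective
    rw [hmap, ProbabilityMeasure.toMeasure_map]
    exact (Measure.map_dirac' (continuous_const_smul g).measurable x).symm
  rw [mem_ofPred_eq]
  beta_reduce
  rw [h1]
  refine map_mem_closure hcont hx ?_
  rintro _ ⟨k, rfl⟩
  refine ⟨g * k, ?_⟩
  apply ProbabilityMeasure.toMeasure_injective
  simp only [ProbabilityMeasure.translate, ProbabilityMeasure.toMeasure_map]
  rw [Measure.map_map (continuous_const_smul g).measurable (continuous_const_smul k).measurable]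
  congr 1
  ext z
  simp [mul_smul]

theorem integral_translate (μ : ProbabilityMeasure X) (g : G) (F : C(X, ℝ)) :
    ∫ x, F x ∂(μ.translate g : Measure X) = ∫ x, F (g • x) ∂(μ : Measure X) := by
  simp only [ProbabilityMeasure.translate, ProbabilityMeasure.toMeasure_map]
  exact integral_map (continuous_const_smul g).measurable.aemeasurable
    F.continuous.stronglyMeasurable.aestronglyMeasurable

theorem not_isConfined_of_isTopologicallyFree [IsTopologicalGroup G] [T2Space G]
    (hX : IsGBoundary G X) (hfree : IsTopologicallyFree G X) (H : ClosedSubgroup G)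
    (hH : H.IsRelativelyAmenable) : ¬ H.IsConfined := by
  have := hX.nonempty
  have := hX.compact
  have := hX.hausdorff
  obtain ⟨μ, hμ, hreg, hinv⟩ := hH X
  obtain ⟨y, hy⟩ := Dense.nonempty hfree
  rw [ClosedSubgroup.isConfined_iff]
  rintro ⟨K, hK, h1, h⟩
  let m : ProbabilityMeasure X := ⟨μ, hμ⟩
  obtain ⟨l, hl⟩ := exists_ultrafilter_tendsto (hX.diracProba_mem_closure (μ := m) hreg y)
  choose k hkH hkK using h
  obtain ⟨a, haK, ha⟩ := hK.ultrafilter_le_nhds (l.map fun ν => k ν)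
    (le_principal_iff.2 (Eventually.of_forall (f := (l : Filter G)) fun ν => hkK ν))
  have ha : Tendsto (fun ν => k ν) l (𝓝 a) := ha
  have hint : ∀ F : C(X, ℝ), Tendsto (fun ν => ∫ x, F x ∂(m.translate ν : Measure X)) l
      (𝓝 (F y)) := fun F => by
    have := ProbabilityMeasure.tendsto_iff_forall_integral_tendsto.1 hl
      (BoundedContinuousFunction.mkOfCompact F)
    simpa [diracProba] using this
  have hfix : ∀ (g : G) (F : C(X, ℝ)), ∫ x, F (k g • x) ∂(m.translate g : Measure X) =
      ∫ x, F x ∂(m.translate g : Measure X) := fun g F => by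
    have e1 := integral_translate m g (F.comp ⟨fun x => k g • x, continuous_const_smul _⟩)
    simp only [ContinuousMap.comp_apply, ContinuousMap.coe_mk] at e1
    rw [e1, integral_translate]
    have hk := hinv _ (ClosedSubgroup.mem_conj_iff.1 (hkH g))
    change ∫ x, F (k g • g • x) ∂μ = ∫ x, F (g • x) ∂μ
    nth_rw 2 [← hk]
    rw [integral_map (continuous_const_smul _).measurable.aemeasurable
      (by fun_prop : Continuous fun x => F (g • x)).stronglyMeasurable.aestronglyMeasurable]
    simp [smul_smul, mul_assoc]
  have hFa : ∀ F : C(X, ℝ), F (a • y) = F y := fun F => by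
    -- By currying, `F (k ν • ·)` converges uniformly to `F (a • ·)`, so the two may be exchanged
    -- under the integral although the measures vary with `ν`.
    let Φ : C(G, C(X, ℝ)) := ContinuousMap.curry ⟨fun p : G × X => F (p.1 • p.2), by fun_prop⟩
    have hΦ : Tendsto (fun ν => Φ (k ν)) l (𝓝 (Φ a)) := (Φ.continuous.tendsto a).comp ha
    have hdiff : Tendsto (fun ν => ∫ x, Φ (k ν) x ∂(m.translate ν : Measure X) -
        ∫ x, Φ a x ∂(m.translate ν : Measure X)) l (𝓝 0) := by
      refine squeeze_zero_norm (fun ν => ?_) (tendsto_iff_norm_sub_tendsto_zero.1 hΦ)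
      rw [← integral_sub]
      · refine (norm_integral_le_of_norm_le_const (C := ‖Φ (k ν) - Φ a‖)
          (Eventually.of_forall fun x => ?_)).trans (by simp)
        exact (Φ (k ν) - Φ a).norm_coe_le_norm x
      · exact (Φ (k ν)).continuous.integrable_of_hasCompactSupport
          (HasCompactSupport.of_compactSpace _)
      · exact (Φ a).continuous.integrable_of_hasCompactSupport
          (HasCompactSupport.of_compactSpace _)
    have h3 := (hint F).sub (hint (Φ a))
    have h4 := tendsto_nhds_unique hdiff (h3.congr fun ν => by
      rw [← hfix]; rfl)
    have : F y - F (a • y) = 0 := h4.symm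
    linarith
  have hay : a • y = y := by
    by_contra hne
    obtain ⟨f, hf0, hf1, -⟩ := exists_continuous_zero_one_of_isClosed
      (isClosed_singleton (x := a • y)) (isClosed_singleton (x := y)) (by simpa using hne)
    have := hFa f
    rw [hf0 rfl, hf1 rfl] at this
    simp at this
  have : a ∈ MulAction.stabilizer G y := hay
  rw [hy, Subgroup.mem_bot] at this
  exact h1 (this ▸ haK)

end Free

/-! ### States, barycenters and extreme points -/

section States

variable {E : Type*} [NormedAddCommGroup E] [NormedSpace ℝ E]

/-- The functionals that are `1` at `u` and nonnegative on `P`. -/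
def stateSet (u : E) (P : Set E) : Set (WeakDual ℝ E) := {φ | φ u = 1 ∧ ∀ f ∈ P, 0 ≤ φ f}

theorem isClosed_stateSet (u : E) (P : Set E) : IsClosed (stateSet u P) := by
  have : stateSet u P = {φ : WeakDual ℝ E | φ u = 1} ∩ ⋂ f ∈ P, {φ : WeakDual ℝ E | 0 ≤ φ f} := by
    ext φ
    simp [stateSet]
  rw [this]
  exact (isClosed_eq (WeakDual.eval_continuous u) continuous_const).inter
    (isClosed_biInter fun f _ => isClosed_le continuous_const (WeakDual.eval_continuous f))

theorem convex_stateSet (u : E) (P : Set E) : Convex ℝ (stateSet u P) := by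
  rintro φ ⟨h1, h2⟩ ψ ⟨h3, h4⟩ a b ha hb hab
  refine ⟨?_, fun f hf => ?_⟩
  · change a * φ u + b * ψ u = 1
    rw [h1, h3]
    linarith
  · change 0 ≤ a * φ f + b * ψ f
    have := h2 f hf
    have := h4 f hf
    positivity

theorem abs_apply_le_of_mem_stateSet {u : E} {P : Set E} (hP : ∀ f, ‖f‖ • u - f ∈ P)
    {φ : WeakDual ℝ E} (hφ : φ ∈ stateSet u P) (f : E) : |φ f| ≤ ‖f‖ := by
  have key : ∀ f, φ f ≤ ‖f‖ := fun f => by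
    have := hφ.2 _ (hP f)
    rw [map_sub, map_smul, hφ.1, smul_eq_mul, mul_one] at this
    linarith
  refine abs_le'.2 ⟨key f, ?_⟩
  simpa using key (-f)

theorem isCompact_stateSet {u : E} {P : Set E} (hP : ∀ f, ‖f‖ • u - f ∈ P) :
    IsCompact (stateSet u P) := by
  refine (WeakDual.isCompact_closedBall (𝕜 := ℝ) (E := E) 0 1).of_isClosed_subset
    (isClosed_stateSet u P) fun φ hφ => ?_
  rw [mem_preimage, mem_closedBall_zero_iff]
  refine ContinuousLinearMap.opNorm_le_bound _ zero_le_one fun f => ?_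
  rw [one_mul, Real.norm_eq_abs]
  exact abs_apply_le_of_mem_stateSet hP hφ f

/-- Hahn–Banach separation: the weak-* continuous functionals are the evaluations at vectors of `E`.
-/
theorem WeakDual.mem_of_forall_le {Q : Set (WeakDual ℝ E)} (hc : Convex ℝ Q) (hQ : IsClosed Q)
    {ψ : WeakDual ℝ E} (h : ∀ (f : E) (c : ℝ), (∀ φ ∈ Q, φ f ≤ c) → ψ f ≤ c) : ψ ∈ Q := by
  by_contra hψ
  have : LocallyConvexSpace ℝ (WeakDual ℝ E) := WeakBilin.locallyConvexSpace
  obtain ⟨L, c, hL, hc⟩ := geometric_hahn_banach_closed_point hc hQ hψ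
  obtain ⟨f, hf⟩ := LinearMap.dualEmbedding_surjective (topDualPairing ℝ E) L
  have hLf : ∀ φ : WeakDual ℝ E, L φ = φ f := fun φ => by
    rw [← hf]
    rfl
  have := h f c fun φ hφ => by
    rw [← hLf]
    exact (hL φ hφ).le
  rw [hLf] at hc
  linarith

/-- The state space of `C(K, ℝ)`. -/
abbrev continuousMapStates (K : Type*) [TopologicalSpace K] [CompactSpace K] :
    Set (WeakDual ℝ C(K, ℝ)) := stateSet 1 {F | 0 ≤ F}

variable {K : Type*} [TopologicalSpace K] [CompactSpace K]

theorem norm_smul_one_sub_nonneg (F : C(K, ℝ)) : ‖F‖ • (1 : C(K, ℝ)) - F ∈ {F : C(K, ℝ) | 0 ≤ F} :=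
  fun k => by simpa using (le_abs_self _).trans (F.norm_coe_le_norm k)

/-- The functions on `K` that the elements of `E` induce through a map from `K` to the dual. -/
noncomputable def evalHat (j : K → WeakDual ℝ E) (hj : Continuous j)
    (hb : ∀ k f, |j k f| ≤ ‖f‖) : E →L[ℝ] C(K, ℝ) :=
  LinearMap.mkContinuous
    { toFun := fun f => ⟨fun k => j k f, (WeakDual.eval_continuous f).comp hj⟩
      map_add' := fun f g => by ext k; exact map_add (j k) f g
      map_smul' := fun c f => by ext k; exact map_smul (j k) c f } 1 fun f => by
    rw [one_mul]
    exact (ContinuousMap.norm_le _ (norm_nonneg f)).2 fun k => hb k f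

variable {j : K → WeakDual ℝ E} (hj : Continuous j) (hb : ∀ k f, |j k f| ≤ ‖f‖)

@[simp]
theorem evalHat_apply (f : E) (k : K) : evalHat j hj hb f k = j k f := rfl

/-- The barycenter of a functional on `C(K, ℝ)`. -/
noncomputable def barycenter (Λ : WeakDual ℝ C(K, ℝ)) : WeakDual ℝ E :=
  ContinuousLinearMap.comp (WeakDual.toStrongDual Λ) (evalHat j hj hb)

@[simp]
theorem barycenter_apply (Λ : WeakDual ℝ C(K, ℝ)) (f : E) :
    barycenter hj hb Λ f = Λ (evalHat j hj hb f) := rfl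

theorem continuous_barycenter : Continuous (barycenter (E := E) hj hb) :=
  WeakDual.continuous_of_continuous_eval fun f => WeakDual.eval_continuous (evalHat j hj hb f)

theorem apply_mono_of_mem_states {Λ : WeakDual ℝ C(K, ℝ)} (hΛ : Λ ∈ continuousMapStates K)
    {F F' : C(K, ℝ)} (h : F ≤ F') : Λ F ≤ Λ F' := by
  have := hΛ.2 (F' - F) (sub_nonneg.2 h)
  rw [map_sub] at this
  linarith

theorem barycenter_mem {Λ : WeakDual ℝ C(K, ℝ)} (hΛ : Λ ∈ continuousMapStates K)
    {Q : Set (WeakDual ℝ E)} (hc : Convex ℝ Q) (hQ : IsClosed Q) (hjQ : ∀ k, j k ∈ Q) :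
    barycenter hj hb Λ ∈ Q := by
  refine WeakDual.mem_of_forall_le hc hQ fun f c hf => ?_
  have := apply_mono_of_mem_states hΛ (F := evalHat j hj hb f) (F' := c • 1) fun k => by
    simpa using hf _ (hjQ k)
  rwa [map_smul, hΛ.1, smul_eq_mul, mul_one] at this

/-- For `0 ≤ h ≤ 1` with `0 < Λ h < 1`, `Λ` is a proper convex combination of its normalized
restrictions by the densities `h` and `1 - h`. Extremality forces the first to have the same
barycenter as `Λ`, which is the identity claimed. -/
theorem apply_mul_evalHat_of_mem_extremePoints {Λ : WeakDual ℝ C(K, ℝ)}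
    (hΛ : Λ ∈ continuousMapStates K)
    {Q : Set (WeakDual ℝ E)} (hc : Convex ℝ Q) (hQ : IsClosed Q) (hjQ : ∀ k, j k ∈ Q)
    (he : barycenter hj hb Λ ∈ Q.extremePoints ℝ) (h : C(K, ℝ)) (f : E) :
    Λ (h * evalHat j hj hb f) = Λ h * Λ (evalHat j hj hb f) := by
  -- the functionals obtained from `Λ` by a positive density have their barycenter in `Q`
  have hdens : ∀ h : C(K, ℝ), 0 ≤ h → 0 < Λ h → ∃ b ∈ Q, ∀ f,
      b f = (Λ h)⁻¹ * Λ (h * evalHat j hj hb f) := fun h h0 hpos => by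
    let Λ' : WeakDual ℝ C(K, ℝ) :=
      StrongDual.toWeakDual ((Λ h)⁻¹ • ContinuousLinearMap.comp (WeakDual.toStrongDual Λ)
        (ContinuousLinearMap.mul ℝ C(K, ℝ) h))
    have happ : ∀ F, Λ' F = (Λ h)⁻¹ * Λ (h * F) := fun F => rfl
    refine ⟨barycenter hj hb Λ', barycenter_mem hj hb ⟨?_, fun F hF => ?_⟩ hc hQ hjQ,
      fun f => happ _⟩
    · rw [happ, mul_one, inv_mul_cancel₀ hpos.ne']
    · rw [happ]
      exact mul_nonneg (inv_nonneg.2 hpos.le) (hΛ.2 _ (mul_nonneg h0 hF))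
  have hsplit : ∀ h : C(K, ℝ), 0 ≤ h → h ≤ 1 → 0 < Λ h → Λ h < 1 → ∀ f,
      Λ (h * evalHat j hj hb f) = Λ h * Λ (evalHat j hj hb f) := fun h h0 h1 hp hp1 f => by
    have hsub : Λ (1 - h) = 1 - Λ h := by rw [map_sub, hΛ.1]
    obtain ⟨b, hbQ, hbf⟩ := hdens h h0 hp
    obtain ⟨b', hbQ', hbf'⟩ := hdens (1 - h) (sub_nonneg.2 h1) (by rw [hsub]; linarith)
    have hmem : barycenter hj hb Λ ∈ openSegment ℝ b b' := by
      refine ⟨Λ h, 1 - Λ h, hp, by linarith, by ring, ?_⟩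
      refine DFunLike.ext _ _ fun f => ?_
      change Λ h * b f + (1 - Λ h) * b' f = Λ (evalHat j hj hb f)
      rw [hbf, hbf', hsub, mul_inv_cancel_left₀ hp.ne', mul_inv_cancel_left₀ (by linarith),
        ← map_add, ← add_mul, add_sub_cancel, one_mul]
    have hbe := he.2 hbQ hbQ' hmem
    have := hbf f
    rw [hbe, barycenter_apply] at this
    rw [this, mul_inv_cancel_left₀ hp.ne']
  -- The identity is affine in `h` and holds for constants, so `h` may be rescaled to `h'` with
  -- values in `[1/4, 3/4]`.
  let t : ℝ := (4 * (‖h‖ + 1))⁻¹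
  have ht : 0 < t := by positivity
  have hbound : ∀ k, |t * h k| ≤ 1 / 4 := fun k => by
    have h1 := h.norm_coe_le_norm k
    rw [Real.norm_eq_abs] at h1
    rw [abs_mul, abs_of_pos ht, inv_mul_le_iff₀ (by positivity)]
    nlinarith [norm_nonneg h]
  let h' : C(K, ℝ) := (1 / 2 : ℝ) • 1 + t • h
  have hval : ∀ k, h' k = 1 / 2 + t * h k := fun k => by simp [h']
  have hlow : Λ ((1 / 4 : ℝ) • 1) ≤ Λ h' := apply_mono_of_mem_states hΛ <| ContinuousMap.le_def.2 fun k => by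
    rw [hval]
    simp only [ContinuousMap.smul_apply, ContinuousMap.one_apply, smul_eq_mul]
    linarith [(abs_le.1 (hbound k)).1]
  have hupp : Λ h' ≤ Λ ((3 / 4 : ℝ) • 1) := apply_mono_of_mem_states hΛ <| ContinuousMap.le_def.2 fun k => by
    rw [hval]
    simp only [ContinuousMap.smul_apply, ContinuousMap.one_apply, smul_eq_mul]
    linarith [(abs_le.1 (hbound k)).2]
  rw [map_smul, hΛ.1, smul_eq_mul, mul_one] at hlow hupp
  have key := hsplit h' (ContinuousMap.le_def.2 fun k => by
      rw [hval]; simp only [ContinuousMap.zero_apply]; linarith [(abs_le.1 (hbound k)).1])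
    (ContinuousMap.le_def.2 fun k => by
      rw [hval]; simp only [ContinuousMap.one_apply]; linarith [(abs_le.1 (hbound k)).2])
    (by linarith) (by linarith) f
  simp only [h', add_mul, smul_mul_assoc, one_mul, map_add, map_smul, hΛ.1, smul_eq_mul,
    mul_one] at key
  have : t * (Λ (h * evalHat j hj hb f)) = t * (Λ h * Λ (evalHat j hj hb f)) := by linarith
  exact mul_left_cancel₀ ht.ne' this

/-- A state on `C(K, ℝ)` whose barycenter is an extreme point is a point evaluation. -/
theorem exists_eq_eval_of_mem_extremePoints [T2Space K] (hinj : Function.Injective j)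
    {Λ : WeakDual ℝ C(K, ℝ)} (hΛ : Λ ∈ continuousMapStates K)
    {Q : Set (WeakDual ℝ E)} (hc : Convex ℝ Q) (hQ : IsClosed Q) (hjQ : ∀ k, j k ∈ Q)
    (he : barycenter hj hb Λ ∈ Q.extremePoints ℝ) :
    ∃ k, j k = barycenter hj hb Λ ∧ ∀ F : C(K, ℝ), Λ F = F k := by
  have hcont : Continuous fun F : C(K, ℝ) => Λ F := Λ.continuous
  -- The functions on which `Λ` is multiplicative form a closed subalgebra, which separates points
  -- as `j` is injective. By Stone–Weierstrass `Λ` is a character.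
  let B : Subalgebra ℝ C(K, ℝ) :=
    { carrier := {F | ∀ h : C(K, ℝ), Λ (h * F) = Λ h * Λ F}
      mul_mem' := fun {F F'} hF hF' h => by rw [← mul_assoc, hF', hF, hF', mul_assoc]
      add_mem' := fun {F F'} hF hF' h => by rw [mul_add, map_add, map_add, hF, hF', mul_add]
      algebraMap_mem' := fun c h => by
        rw [Algebra.algebraMap_eq_smul_one, mul_smul_comm, mul_one, map_smul, map_smul, hΛ.1,
          smul_eq_mul, smul_eq_mul, mul_one, mul_comm] }
  have hBc : IsClosed (B : Set C(K, ℝ)) := by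
    have : (B : Set C(K, ℝ)) = ⋂ h : C(K, ℝ), {F | Λ (h * F) = Λ h * Λ F} := by
      ext F
      simp [B]
    rw [this]
    exact isClosed_iInter fun h => isClosed_eq (hcont.comp (continuous_const.mul continuous_id))
      (continuous_const.mul hcont)
  have hsep : B.SeparatesPoints := fun x y hxy => by
    have hne : j x ≠ j y := hinj.ne hxy
    obtain ⟨f, hf⟩ := DFunLike.ne_iff.1 hne
    exact ⟨_, ⟨evalHat j hj hb f, fun h =>
      apply_mul_evalHat_of_mem_extremePoints hj hb hΛ hc hQ hjQ he h f, rfl⟩, hf⟩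
  have hB : ∀ F, F ∈ B := fun F => by
    have h1 := ContinuousMap.subalgebra_topologicalClosure_eq_top_of_separatesPoints B hsep
    have h2 : F ∈ B.topologicalClosure := h1 ▸ Algebra.mem_top
    exact hBc.closure_subset h2
  have hchar : Λ ∈ WeakDual.characterSpace ℝ C(K, ℝ) :=
    ⟨fun h => zero_ne_one (α := ℝ) (by simpa only [h] using! hΛ.1), fun F F' => hB F' F⟩
  obtain ⟨k, hk⟩ := (WeakDual.CharacterSpace.continuousMapEval_bijective (X := K) (𝕜 := ℝ)).2
    ⟨Λ, hchar⟩
  have hev : ∀ F : C(K, ℝ), Λ F = F k := fun F => by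
    have := congrArg (fun χ : WeakDual.characterSpace ℝ C(K, ℝ) => χ F) hk
    exact this.symm
  refine ⟨k, DFunLike.ext _ _ fun f => ?_, hev⟩
  rw [barycenter_apply, hev, evalHat_apply]

/-- Milman's theorem in the dual of a normed space. -/
theorem mem_of_mem_extremePoints_closure_convexHull {S Q : Set (WeakDual ℝ E)} (hS : IsCompact S)
    (hbound : ∀ φ ∈ S, ∀ f, |φ f| ≤ ‖f‖) (hSQ : closure (convexHull ℝ S) = Q)
    {e : WeakDual ℝ E} (he : e ∈ Q.extremePoints ℝ) : e ∈ S := by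
  have : CompactSpace S := isCompact_iff_compactSpace.1 hS
  have hj : Continuous (Subtype.val : S → WeakDual ℝ E) := continuous_subtype_val
  have hb : ∀ (k : S) f, |(k : WeakDual ℝ E) f| ≤ ‖f‖ := fun k f => hbound k k.2 f
  have hQc : Convex ℝ Q := hSQ ▸ (convex_convexHull ℝ S).closure
  have hQcl : IsClosed Q := hSQ ▸ isClosed_closure
  have hSQ' : S ⊆ Q := hSQ ▸ (subset_convexHull ℝ S).trans subset_closure
  -- The barycenters form a compact convex set containing `S`, hence `Q`; so `e` is itself a
  -- barycenter.
  let B := barycenter hj hb '' continuousMapStates S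
  have hBcomp : IsCompact B :=
    (isCompact_stateSet norm_smul_one_sub_nonneg).image (continuous_barycenter hj hb)
  have hBconv : Convex ℝ B := by
    rintro _ ⟨Λ, hΛ, rfl⟩ _ ⟨Λ', hΛ', rfl⟩ a b h1 h2 h3
    exact ⟨a • Λ + b • Λ', convex_stateSet _ _ hΛ hΛ' h1 h2 h3, rfl⟩
  have hSB : S ⊆ B := fun φ hφ => by
    refine ⟨StrongDual.toWeakDual (ContinuousMap.evalCLM ℝ (⟨φ, hφ⟩ : S)),
      ⟨rfl, fun F hF => hF ⟨φ, hφ⟩⟩, rfl⟩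
  have heB : e ∈ B := by
    have := closure_minimal (convexHull_min hSB hBconv) hBcomp.isClosed
    rw [hSQ] at this
    exact this he.1
  obtain ⟨Λ, hΛ, rfl⟩ := heB
  obtain ⟨k, hk, -⟩ := exists_eq_eval_of_mem_extremePoints hj hb Subtype.val_injective hΛ hQc hQcl
    (fun k => hSQ' k.2) he
  exact hk ▸ k.2

end States

/-! ### Probability measures as states -/

section IntegralState

variable {X : Type*} [TopologicalSpace X] [CompactSpace X] [MeasurableSpace X] [BorelSpace X]

theorem ContinuousMap.integrable_of_compactSpace (μ : ProbabilityMeasure X) (F : C(X, ℝ)) :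
    Integrable F (μ : Measure X) :=
  F.continuous.integrable_of_hasCompactSupport (HasCompactSupport.of_compactSpace _)

/-- Integration against a probability measure, as a functional on `C(X, ℝ)`. -/
noncomputable def integralState (μ : ProbabilityMeasure X) : WeakDual ℝ C(X, ℝ) :=
  StrongDual.toWeakDual <| LinearMap.mkContinuous
    { toFun := fun F => ∫ x, F x ∂(μ : Measure X)
      map_add' := fun F F' => integral_add (F.integrable_of_compactSpace μ)
        (F'.integrable_of_compactSpace μ)
      map_smul' := fun c F => integral_const_mul c _ } 1 fun F => by
    refine (norm_integral_le_of_norm_le_const (C := ‖F‖)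
      (Eventually.of_forall fun x => F.norm_coe_le_norm x)).trans (by simp)

theorem integralState_apply (μ : ProbabilityMeasure X) (F : C(X, ℝ)) :
    integralState μ F = ∫ x, F x ∂(μ : Measure X) := rfl

theorem integralState_mem (μ : ProbabilityMeasure X) :
    integralState μ ∈ continuousMapStates X := by
  refine ⟨?_, fun F hF => ?_⟩
  · simp [integralState_apply]
  · exact integral_nonneg hF

end IntegralState

/-! ### A boundary inside the state space -/

section DualAction

variable {G E : Type u} [Group G] [NormedAddCommGroup E] [NormedSpace ℝ E]

/-- The contragredient of a linear representation. -/
noncomputable def dualAct (ρ : G →* (E →L[ℝ] E)) (g : G) (φ : WeakDual ℝ E) : WeakDual ℝ E :=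
  StrongDual.toWeakDual ((WeakDual.toStrongDual φ).comp (ρ g⁻¹))

variable (ρ : G →* (E →L[ℝ] E))

@[simp]
theorem dualAct_apply (g : G) (φ : WeakDual ℝ E) (f : E) : dualAct ρ g φ f = φ (ρ g⁻¹ f) := rfl

theorem dualAct_one (φ : WeakDual ℝ E) : dualAct ρ 1 φ = φ :=
  DFunLike.ext _ _ fun f => by simp

theorem dualAct_mul (g h : G) (φ : WeakDual ℝ E) :
    dualAct ρ (g * h) φ = dualAct ρ g (dualAct ρ h φ) :=
  DFunLike.ext _ _ fun f => by simp

theorem continuous_dualAct (g : G) : Continuous (dualAct ρ g) :=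
  WeakDual.continuous_of_continuous_eval fun f => WeakDual.eval_continuous (ρ g⁻¹ f)

variable {ρ} {u : E} {P : Set E}

theorem dualAct_mem_stateSet (hu : ∀ g, ρ g u = u) (hρP : ∀ g, ∀ f ∈ P, ρ g f ∈ P) (g : G)
    {φ : WeakDual ℝ E} (hφ : φ ∈ stateSet u P) : dualAct ρ g φ ∈ stateSet u P :=
  ⟨by rw [dualAct_apply, hu, hφ.1], fun f hf => hφ.2 _ (hρP _ f hf)⟩

/-- The bound `|φ f| ≤ ‖f‖`, uniform over states, combines norm continuity in `g` with weak-*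
continuity in `φ`. -/
theorem continuous_dualAct_stateSet [TopologicalSpace G] [IsTopologicalGroup G]
    (hP : ∀ f, ‖f‖ • u - f ∈ P) (hρ : ∀ f, Continuous fun g => ρ g f) :
    Continuous fun p : G × stateSet u P => dualAct ρ p.1 p.2 := by
  refine WeakDual.continuous_of_continuous_eval fun f => ?_
  simp only [dualAct_apply]
  rw [continuous_iff_continuousAt]
  rintro ⟨g₀, φ₀⟩
  have h1 : Tendsto (fun p : G × stateSet u P => (p.2 : WeakDual ℝ E) (ρ g₀⁻¹ f)) (𝓝 (g₀, φ₀))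
      (𝓝 ((φ₀ : WeakDual ℝ E) (ρ g₀⁻¹ f))) :=
    ((WeakDual.eval_continuous (ρ g₀⁻¹ f)).comp
      (continuous_subtype_val.comp continuous_snd)).tendsto (g₀, φ₀)
  have h2 : Tendsto (fun p : G × stateSet u P => ρ p.1⁻¹ f) (𝓝 (g₀, φ₀)) (𝓝 (ρ g₀⁻¹ f)) :=
    ((hρ f).comp (continuous_inv.comp continuous_fst)).tendsto (g₀, φ₀)
  have h3 : Tendsto (fun p : G × stateSet u P => (p.2 : WeakDual ℝ E) (ρ p.1⁻¹ f - ρ g₀⁻¹ f))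
      (𝓝 (g₀, φ₀)) (𝓝 0) :=
    squeeze_zero_norm (fun p => abs_apply_le_of_mem_stateSet hP p.2.2 _)
      (tendsto_iff_norm_sub_tendsto_zero.1 h2)
  have h4 := h3.add h1
  rw [zero_add] at h4
  refine h4.congr fun p => ?_
  rw [map_sub, sub_add_cancel]

/-- The nonempty closed convex invariant sets of states. -/
def invariantStateSets (ρ : G →* (E →L[ℝ] E)) (u : E) (P : Set E) : Set (Set (WeakDual ℝ E)) :=
  {Q | Q.Nonempty ∧ IsClosed Q ∧ Convex ℝ Q ∧ Q ⊆ stateSet u P ∧ ∀ g, ∀ φ ∈ Q, dualAct ρ g φ ∈ Q}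

theorem exists_minimal_invariantStateSet (hP : ∀ f, ‖f‖ • u - f ∈ P) (hu : ∀ g, ρ g u = u)
    (hρP : ∀ g, ∀ f ∈ P, ρ g f ∈ P) (hne : (stateSet u P).Nonempty) :
    ∃ Q, Minimal (· ∈ invariantStateSets ρ u P) Q := by
  refine zorn_superset _ fun c hc hchain => ?_
  rcases c.eq_empty_or_nonempty with rfl | hcne
  · exact ⟨stateSet u P, ⟨hne, isClosed_stateSet u P, convex_stateSet u P, Subset.rfl,
      fun g φ => dualAct_mem_stateSet hu hρP g⟩, by simp⟩
  · refine ⟨⋂₀ c, ⟨?_, isClosed_sInter fun Q hQ => (hc hQ).2.1,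
      convex_sInter fun Q hQ => (hc hQ).2.2.1, ?_, fun g φ hφ Q hQ =>
        (hc hQ).2.2.2.2 g φ (hφ Q hQ)⟩, fun Q hQ => sInter_subset_of_mem hQ⟩
    · have := hcne.to_subtype
      exact IsCompact.nonempty_sInter_of_directed_nonempty_isCompact_isClosed
        (fun a ha b hb => (hchain.total ha hb).elim (fun h => ⟨a, ha, Subset.rfl, h⟩)
          fun h => ⟨b, hb, h, Subset.rfl⟩)
        (fun Q hQ => (hc hQ).1)
        (fun Q hQ => (isCompact_stateSet hP).of_isClosed_subset (hc hQ).2.1 (hc hQ).2.2.2.1)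
        (fun Q hQ => (hc hQ).2.1)
    · obtain ⟨Q, hQ⟩ := hcne
      exact (sInter_subset_of_mem hQ).trans (hc hQ).2.2.2.1

theorem dualAct_mem_closure_range (g : G) {φ b : WeakDual ℝ E}
    (hφ : φ ∈ closure (range fun g => dualAct ρ g b)) :
    dualAct ρ g φ ∈ closure (range fun g => dualAct ρ g b) := by
  refine map_mem_closure (continuous_dualAct ρ g) hφ ?_
  rintro _ ⟨k, rfl⟩
  exact ⟨g * k, dualAct_mul ρ g k b⟩

theorem closure_range_dualAct_subset {S : Set (WeakDual ℝ E)} (hS : IsClosed S)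
    (hinv : ∀ g, ∀ φ ∈ S, dualAct ρ g φ ∈ S) {b : WeakDual ℝ E} (hb : b ∈ S) :
    closure (range fun g => dualAct ρ g b) ⊆ S := by
  refine closure_minimal ?_ hS
  rintro _ ⟨g, rfl⟩
  exact hinv g b hb

/-- An extreme point of a minimal invariant set of states lies in every orbit closure. -/
theorem mem_closure_range_dualAct_of_mem_extremePoints (hP : ∀ f, ‖f‖ • u - f ∈ P)
    {Q : Set (WeakDual ℝ E)} (hQ : Minimal (· ∈ invariantStateSets ρ u P) Q)
    {e b : WeakDual ℝ E} (he : e ∈ Q.extremePoints ℝ) (hb : b ∈ Q) :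
    e ∈ closure (range fun g => dualAct ρ g b) := by
  obtain ⟨-, hQcl, hQc, hQs, hQinv⟩ := hQ.prop
  have hRQ := closure_range_dualAct_subset hQcl hQinv hb
  set R := closure (range fun g => dualAct ρ g b) with hR
  have hRcomp : IsCompact R :=
    (isCompact_stateSet hP).of_isClosed_subset isClosed_closure (hRQ.trans hQs)
  have hsub : closure (convexHull ℝ R) ⊆ Q := closure_minimal (convexHull_min hRQ hQc) hQcl
  have hmem : closure (convexHull ℝ R) ∈ invariantStateSets ρ u P := by
    have hRne : R.Nonempty := (range_nonempty _).closure
    refine ⟨(convexHull_nonempty_iff.2 hRne).closure, isClosed_closure,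
      (convex_convexHull ℝ R).closure, hsub.trans hQs, fun g => ?_⟩
    change closure (convexHull ℝ R) ⊆ dualAct ρ g ⁻¹' closure (convexHull ℝ R)
    refine closure_minimal (convexHull_min (fun φ hφ => ?_) ?_)
      (isClosed_closure.preimage (continuous_dualAct ρ g))
    · exact subset_closure (subset_convexHull ℝ R (dualAct_mem_closure_range g hφ))
    · intro φ hφ ψ hψ a b ha hb hab
      exact (convex_convexHull ℝ R).closure hφ hψ ha hb hab
  exact mem_of_mem_extremePoints_closure_convexHull hRcomp
    (fun φ hφ => abs_apply_le_of_mem_stateSet hP (hQs (hRQ hφ)))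
    (hsub.antisymm (hQ.le_of_le hmem hsub)) he

/-- The state space of a continuous representation contains a boundary. -/
theorem exists_isGBoundary [TopologicalSpace G] [IsTopologicalGroup G]
    (hP : ∀ f, ‖f‖ • u - f ∈ P) (hu : ∀ g, ρ g u = u)
    (hρP : ∀ g, ∀ f ∈ P, ρ g f ∈ P) (hρ : ∀ f, Continuous fun g => ρ g f)
    (hne : (stateSet u P).Nonempty) :
    ∃ (X : Type u) (_ : TopologicalSpace X) (_ : MeasurableSpace X) (_ : BorelSpace X)
        (_ : MulAction G X) (_ : ContinuousSMul G X) (ι : X → WeakDual ℝ E),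
        IsGBoundary G X ∧ ∀ x, ι x ∈ stateSet u P ∧ ∀ g : G, ι (g • x) = dualAct ρ g (ι x) := by
  obtain ⟨Q, hQ⟩ := exists_minimal_invariantStateSet hP hu hρP hne
  obtain ⟨hQne, hQcl, hQc, hQs, hQinv⟩ := hQ.prop
  have hQcomp : IsCompact Q := (isCompact_stateSet hP).of_isClosed_subset hQcl hQs
  have : LocallyConvexSpace ℝ (WeakDual ℝ E) := WeakBilin.locallyConvexSpace
  obtain ⟨e, he⟩ := hQcomp.extremePoints_nonempty hQne
  let X := closure (range fun g => dualAct ρ g e)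
  have hXQ : X ⊆ Q := closure_range_dualAct_subset hQcl hQinv he.1
  have heX : e ∈ X := subset_closure ⟨1, dualAct_one ρ e⟩
  let : MulAction G X :=
    { smul := fun g x => ⟨dualAct ρ g x, dualAct_mem_closure_range g x.2⟩
      one_smul := fun x => Subtype.ext (dualAct_one ρ x)
      mul_smul := fun g h x => Subtype.ext (dualAct_mul ρ g h x) }
  have hsmul : ∀ (g : G) (x : X), ((g • x : X) : WeakDual ℝ E) = dualAct ρ g x := fun _ _ => rfl
  have hcs : ContinuousSMul G X := ⟨by
    refine Continuous.subtype_mk ?_ _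
    exact (continuous_dualAct_stateSet hP hρ).comp (continuous_fst.prodMk
      (continuous_inclusion (hXQ.trans hQs) |>.comp continuous_snd))⟩
  let : MeasurableSpace X := borel X
  have hborel : BorelSpace X := ⟨rfl⟩
  have hcomp : CompactSpace X :=
    isCompact_iff_compactSpace.1 (hQcomp.of_isClosed_subset isClosed_closure hXQ)
  refine ⟨X, inferInstance, inferInstance, hborel, inferInstance, hcs, Subtype.val,
    ⟨⟨⟨e, heX⟩⟩, hcomp, inferInstance, ⟨fun x y => ?_⟩, fun μ _ => ?_⟩,
    fun x => ⟨hQs (hXQ x.2), fun g => hsmul g x⟩⟩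
  · rw [closure_subtype]
    have h1 := mem_closure_range_dualAct_of_mem_extremePoints hP hQ he (hXQ x.2)
    have h2 := closure_range_dualAct_subset isClosed_closure
      (fun g φ => dualAct_mem_closure_range g) h1 y.2
    rwa [MulAction.orbit, ← range_comp]
  · have hj : Continuous (Subtype.val : X → WeakDual ℝ E) := continuous_subtype_val
    have hb : ∀ (k : X) f, |(k : WeakDual ℝ E) f| ≤ ‖f‖ := fun k f =>
      abs_apply_le_of_mem_stateSet hP (hQs (hXQ k.2)) f
    have hbar : ∀ g, barycenter hj hb (integralState (μ.translate g)) =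
        dualAct ρ g (barycenter hj hb (integralState μ)) := fun g => DFunLike.ext _ _ fun f => by
      rw [barycenter_apply, integralState_apply, integral_translate]
      rfl
    -- The barycenter of `μ` lies in `Q`, so its translates accumulate at `e`. Compactness then
    -- gives a limit state `Λ` with barycenter `e`.
    have hbQ := barycenter_mem hj hb (integralState_mem μ) hQc hQcl fun k => hXQ k.2
    obtain ⟨l, hl⟩ := exists_ultrafilter_tendsto
      (mem_closure_range_dualAct_of_mem_extremePoints hP hQ he hbQ)
    obtain ⟨Λ, hΛ, hlim⟩ := (isCompact_stateSet norm_smul_one_sub_nonneg).ultrafilter_le_nhds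
      (l.map fun g => integralState (μ.translate g))
      (le_principal_iff.2 (Eventually.of_forall (f := (l : Filter G)) fun g =>
        integralState_mem (μ.translate g)))
    have hlim : Tendsto (fun g => integralState (μ.translate g)) (l : Filter G) (𝓝 Λ) := hlim
    have hΛe : barycenter hj hb Λ = e := by
      refine tendsto_nhds_unique (((continuous_barycenter hj hb).tendsto Λ).comp hlim) ?_
      exact hl.congr fun g => (hbar g).symm
    obtain ⟨x, -, hx⟩ := exists_eq_eval_of_mem_extremePoints hj hb Subtype.val_injective hΛ hQc
      hQcl (fun k => hXQ k.2) (hΛe ▸ he)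
    refine ⟨x, mem_closure_of_tendsto (b := (l : Filter G)) (f := fun g => μ.translate g) ?_
      (Eventually.of_forall fun g => ⟨g, rfl⟩)⟩
    refine ProbabilityMeasure.tendsto_iff_forall_integral_tendsto.2 fun F => ?_
    have := ((WeakDual.eval_continuous F.toContinuousMap).tendsto Λ).comp hlim
    rw [hx] at this
    simpa [diracProba, Function.comp_def, integralState_apply] using this

end DualAction

/-! ### Functions with norm continuous left translation -/

section UniformlyContinuous

open scoped BoundedContinuousFunction

variable (G : Type u) [Group G] [TopologicalSpace G] [IsTopologicalGroup G]

/-- Left translation on the bounded continuous functions. -/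
noncomputable def leftTranslation : G →* ((G →ᵇ ℝ) →L[ℝ] (G →ᵇ ℝ)) where
  toFun g := BoundedContinuousFunction.compContinuousCLM ℝ ℝ ⟨fun x => g⁻¹ * x, by fun_prop⟩
  map_one' := by
    ext f x
    change f (1⁻¹ * x) = f x
    simp
  map_mul' g h := by
    ext f x
    change f ((g * h)⁻¹ * x) = f (h⁻¹ * (g⁻¹ * x))
    simp [mul_assoc]

@[simp]
theorem leftTranslation_apply (g : G) (f : G →ᵇ ℝ) (x : G) :
    leftTranslation G g f x = f (g⁻¹ * x) := rfl

/-- The bounded functions on `G` on which left translation is norm continuous. -/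
noncomputable def uniformFunctions : Submodule ℝ (G →ᵇ ℝ) where
  carrier := {f | Continuous fun g => leftTranslation G g f}
  zero_mem' := by simpa using continuous_const
  add_mem' hf hf' := by simpa using! hf.add hf'
  smul_mem' c f hf := by simpa using! hf.const_smul c

variable {G}

theorem mem_uniformFunctions {f : G →ᵇ ℝ} :
    f ∈ uniformFunctions G ↔ Continuous fun g => leftTranslation G g f := Iff.rfl

theorem leftTranslation_mem (g : G) {f : G →ᵇ ℝ} (hf : f ∈ uniformFunctions G) :
    leftTranslation G g f ∈ uniformFunctions G := by
  rw [mem_uniformFunctions] at hf ⊢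
  refine (hf.comp (continuous_mul_const g)).congr fun h => ?_
  simp

variable (G) in
/-- Left translation on `uniformFunctions G`. -/
noncomputable def uniformTranslation : G →* (uniformFunctions G →L[ℝ] uniformFunctions G) where
  toFun g := ((leftTranslation G g).comp (uniformFunctions G).subtypeL).codRestrict _
    fun f => leftTranslation_mem g f.2
  map_one' := by ext f x; simp
  map_mul' g h := by
    ext f x
    change (f : G →ᵇ ℝ) ((g * h)⁻¹ * x) = (f : G →ᵇ ℝ) (h⁻¹ * (g⁻¹ * x))
    simp [mul_assoc]

@[simp]
theorem uniformTranslation_apply (g : G) (f : uniformFunctions G) (x : G) :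
    (uniformTranslation G g f : G →ᵇ ℝ) x = (f : G →ᵇ ℝ) (g⁻¹ * x) := rfl

theorem continuous_uniformTranslation (f : uniformFunctions G) :
    Continuous fun g => uniformTranslation G g f :=
  Continuous.subtype_mk f.2 _

variable (G) in
/-- The constant function `1`. -/
noncomputable def uniformOne : uniformFunctions G :=
  ⟨1, mem_uniformFunctions.2 (continuous_const (y := (1 : G →ᵇ ℝ)).congr fun g => by ext x; rfl)⟩

@[simp]
theorem uniformOne_apply (x : G) : (uniformOne G : G →ᵇ ℝ) x = 1 := rfl

variable (G) in
/-- The nonnegative functions in `uniformFunctions G`. -/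
def uniformNonneg : Set (uniformFunctions G) := {f | ∀ x, 0 ≤ (f : G →ᵇ ℝ) x}

theorem norm_smul_uniformOne_sub_mem (f : uniformFunctions G) :
    ‖f‖ • uniformOne G - f ∈ uniformNonneg G := fun x => by
  simpa using! (le_abs_self _).trans ((f : G →ᵇ ℝ).norm_coe_le_norm x)

theorem stateSet_uniformFunctions_nonempty :
    (stateSet (uniformOne G) (uniformNonneg G)).Nonempty :=
  ⟨StrongDual.toWeakDual ((BoundedContinuousFunction.evalCLM ℝ (1 : G)).comp
    (uniformFunctions G).subtypeL), rfl, fun _ hf => hf 1⟩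

variable {Z : Type u} [TopologicalSpace Z] [CompactSpace Z] [MulAction G Z] [ContinuousSMul G Z]

/-- The map from `C(Z, ℝ)` to `uniformFunctions G` given by a point of a compact `G`-space `Z`,
as a linear map. -/
noncomputable def orbitPullbackLinear (z : Z) : C(Z, ℝ) →ₗ[ℝ] uniformFunctions G where
  toFun F := ⟨BoundedContinuousFunction.compContinuous
    (BoundedContinuousFunction.mkOfCompact F) ⟨fun g : G => g • z, by fun_prop⟩, by
      -- The supremum over the orbit of `z` is at most that over `Z`, where translation is norm
      -- continuous by currying.
      let Φ : C(G, C(Z, ℝ)) :=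
        ContinuousMap.curry ⟨fun p : G × Z => F (p.1⁻¹ • p.2), by fun_prop⟩
      refine continuous_iff_continuousAt.2 fun g₀ => ?_
      refine tendsto_iff_norm_sub_tendsto_zero.2 (squeeze_zero (fun _ => norm_nonneg _)
        (fun g => ?_) (tendsto_iff_norm_sub_tendsto_zero.1 (Φ.continuous.tendsto g₀)))
      refine (BoundedContinuousFunction.norm_le (norm_nonneg _)).2 fun x => ?_
      refine le_trans (le_of_eq ?_) ((Φ g - Φ g₀).norm_coe_le_norm (x • z))
      simp [Φ, mul_smul]⟩
  map_add' F F' := by ext; rfl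
  map_smul' c F := by ext; rfl

/-- The map from `C(Z, ℝ)` to `uniformFunctions G` given by a point of a compact `G`-space `Z`. -/
noncomputable def orbitPullback (z : Z) : C(Z, ℝ) →L[ℝ] uniformFunctions G :=
  ⟨orbitPullbackLinear z, AddMonoidHomClass.continuous_of_bound (orbitPullbackLinear z) 1
    fun F : C(Z, ℝ) => by
      rw [one_mul]
      exact (BoundedContinuousFunction.norm_le (norm_nonneg _)).2 fun x => F.norm_coe_le_norm _⟩

end UniformlyContinuous

/-! ### States as regular measures -/

section Riesz

variable {Z : Type*} [TopologicalSpace Z] [CompactSpace Z] [T2Space Z] [MeasurableSpace Z]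
  [BorelSpace Z]

open scoped CompactlySupported

theorem exists_measure_of_mem_states {Λ : WeakDual ℝ C(Z, ℝ)} (hΛ : Λ ∈ continuousMapStates Z) :
    ∃ μ : Measure Z, IsProbabilityMeasure μ ∧ μ.Regular ∧ ∀ F : C(Z, ℝ), ∫ z, F z ∂μ = Λ F := by
  let Λ' : C_c(Z, ℝ) →ₚ[ℝ] ℝ :=
    { toFun := fun F => Λ F.toContinuousMap
      map_add' := fun F F' => map_add Λ F.toContinuousMap F'.toContinuousMap
      map_smul' := fun c F => map_smul Λ c F.toContinuousMap
      monotone' := fun F F' h => apply_mono_of_mem_states hΛ h }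
  have hint : ∀ F : C(Z, ℝ), ∫ z, F z ∂(RealRMK.rieszMeasure Λ') = Λ F := fun F =>
    RealRMK.integral_rieszMeasure Λ' ⟨F, HasCompactSupport.of_compactSpace _⟩
  refine ⟨RealRMK.rieszMeasure Λ', ⟨?_⟩, inferInstance, hint⟩
  have h1 := hint 1
  rw [hΛ.1] at h1
  simpa [Measure.real, ENNReal.toReal_eq_one_iff] using h1

end Riesz

/-! ### Stabilizers of states -/

section RelativelyAmenable

variable {G : Type u} [Group G] [TopologicalSpace G] [IsTopologicalGroup G]

/-- An orbit map `g ↦ g • z` pulls `C(Z, ℝ)` back equivariantly, so an invariant state induces an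
invariant measure on `Z`. -/
theorem isRelativelyAmenable_of_fixes_state {H : ClosedSubgroup G}
    {φ : WeakDual ℝ (uniformFunctions G)} (hφ : φ ∈ stateSet (uniformOne G) (uniformNonneg G))
    (hH : ∀ h ∈ H, dualAct (E := uniformFunctions G) (uniformTranslation G) h φ = φ) : H.IsRelativelyAmenable := by
  intro Z _ _ _ _ _ _ _ _
  obtain ⟨z⟩ := ‹Nonempty Z›
  let Λ : WeakDual ℝ C(Z, ℝ) :=
    StrongDual.toWeakDual ((WeakDual.toStrongDual φ).comp (orbitPullback (G := G) z))
  have hΛapp : ∀ F, Λ F = φ (orbitPullback z F) := fun F => rfl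
  have hΛ : Λ ∈ continuousMapStates Z := ⟨hφ.1, fun F hF => hφ.2 _ fun x => hF (x • z)⟩
  obtain ⟨μ, hμ, hreg, hint⟩ := exists_measure_of_mem_states hΛ
  refine ⟨μ, hμ, hreg, fun h hh => ?_⟩
  have hcont : Continuous fun x : Z => h • x := continuous_const_smul h
  have : (μ.map fun x : Z => h • x).Regular :=
    Measure.Regular.map (Homeomorph.smul h)
  have : IsProbabilityMeasure (μ.map fun x : Z => h • x) :=
    Measure.isProbabilityMeasure_map hcont.measurable.aemeasurable
  refine Measure.ext_of_integral_eq_on_compactlySupported fun F => ?_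
  rw [integral_map hcont.measurable.aemeasurable
    (map_continuous F).stronglyMeasurable.aestronglyMeasurable]
  let F' : C(Z, ℝ) := F.toContinuousMap.comp ⟨fun x => h • x, hcont⟩
  refine (hint F').trans (Eq.trans ?_ (hint F.toContinuousMap).symm)
  rw [hΛapp, hΛapp]
  have hfix := DFunLike.congr_fun (hH h hh) (orbitPullback z F.toContinuousMap)
  rw [dualAct_apply] at hfix
  rw [← hfix]
  congr 1
  ext x
  change F (h • x • z) = F ((h⁻¹⁻¹ * x) • z)
  rw [inv_inv, mul_smul]

end RelativelyAmenable

/-! ### Topological freeness by Baire category -/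

section TopologicallyFree

variable {G X : Type u} [Group G] [TopologicalSpace G] [TopologicalSpace X] [T2Space X]
  [MulAction G X] [ContinuousSMul G X]

/-- The complement is the projection of a closed subset of `K × X` along the compact factor. -/
theorem isOpen_setOf_stabilizer_inter_eq_empty {K : Set G} (hK : IsCompact K) :
    IsOpen {x : X | (MulAction.stabilizer G x : Set G) ∩ K = ∅} := by
  have hcl : IsClosed {p : G × X | p.1 • p.2 = p.2} := isClosed_eq continuous_smul continuous_snd
  have : CompactSpace K := isCompact_iff_compactSpace.1 hK
  have hcl' : IsClosed {p : K × X | (p.1 : G) • p.2 = p.2} :=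
    hcl.preimage ((continuous_subtype_val.comp continuous_fst).prodMk continuous_snd)
  have himg := isClosedMap_snd_of_compactSpace _ hcl'
  rw [← isClosed_compl_iff]
  convert himg using 1
  ext x
  simp only [mem_compl_iff, mem_ofPred_eq, ← Ne.eq_def, ← nonempty_iff_ne_empty, mem_image,
    Prod.exists, exists_eq_right, Subtype.exists]
  exact ⟨fun ⟨g, hg, hgK⟩ => ⟨g, hgK, hg⟩, fun ⟨g, hgK, hg⟩ => ⟨g, hg, hgK⟩⟩

omit [T2Space X] in
theorem dense_setOf_stabilizer_inter_eq_empty [IsTopologicalGroup G] [CompactSpace X]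
    [MulAction.IsMinimal G X] {y : X}
    (hy : ∀ K : Set G, IsCompact K → (1 : G) ∉ K →
      ∃ g : G, (MulAction.stabilizer G (g • y) : Set G) ∩ K = ∅)
    {K : Set G} (hK : IsCompact K) (h1 : (1 : G) ∉ K) :
    Dense {x : X | (MulAction.stabilizer G x : Set G) ∩ K = ∅} := by
  refine dense_iff_inter_open.2 fun V hV hVne => ?_
  obtain ⟨I, hI⟩ := isCompact_univ.exists_finite_cover_smul G hV hVne
  -- Finitely many translates of `V` cover `X`. If the stabilizer of `g • y` misses these conjugates
  -- of `K`, then moving `g • y` back into `V` gives a point whose stabilizer misses `K`.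
  let L : Set G := ⋃ g ∈ I, (fun k => g * k * g⁻¹) '' K
  have hL : IsCompact L := I.isCompact_biUnion fun g _ => hK.image (by fun_prop)
  have h1L : (1 : G) ∉ L := by
    simp only [L, mem_iUnion, mem_image, not_exists, not_and]
    intro g _ k hk h
    rw [mul_inv_eq_one, mul_eq_left] at h
    exact h1 (h ▸ hk)
  obtain ⟨g, hg⟩ := hy L hL h1L
  obtain ⟨f, hf, v, hv, hfv⟩ : ∃ f ∈ I, ∃ v ∈ V, f • v = g • y := by
    simpa [mem_smul_set] using hI (mem_univ (g • y))
  refine ⟨v, hv, eq_empty_iff_forall_notMem.2 ?_⟩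
  rintro k ⟨hk, hkK⟩
  refine eq_empty_iff_forall_notMem.1 hg (f * k * f⁻¹) ⟨?_, ?_⟩
  · have hk : k • v = v := hk
    change (f * k * f⁻¹) • g • y = g • y
    rw [← hfv, mul_smul, inv_smul_smul, mul_smul, hk]
  · exact mem_biUnion hf ⟨k, hkK, rfl⟩

/-- The complement of `1` is a countable union of compact sets, so the points with trivial
stabilizer contain a countable intersection of dense open sets. -/
theorem isTopologicallyFree_of_forall_compact [IsTopologicalGroup G] [LocallyCompactSpace G]
    [SecondCountableTopology G] [T2Space G] [CompactSpace X] [MulAction.IsMinimal G X] {y : X}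
    (hy : ∀ K : Set G, IsCompact K → (1 : G) ∉ K →
      ∃ g : G, (MulAction.stabilizer G (g • y) : Set G) ∩ K = ∅) :
    IsTopologicallyFree G X := by
  have hopen : IsOpen ({1}ᶜ : Set G) := isOpen_compl_singleton
  have : LocallyCompactSpace ({1}ᶜ : Set G) := hopen.locallyCompactSpace
  let C := compactCovering ({1}ᶜ : Set G)
  have hC : ∀ n, IsCompact (Subtype.val '' C n) := fun n =>
    (isCompact_compactCovering _ n).image continuous_subtype_val
  have hC1 : ∀ n, (1 : G) ∉ Subtype.val '' C n := by
    rintro n ⟨x, -, hx⟩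
    exact x.2 hx
  have hdense := dense_iInter_of_isOpen
    (fun n => isOpen_setOf_stabilizer_inter_eq_empty (X := X) (hC n))
    (fun n => dense_setOf_stabilizer_inter_eq_empty hy (hC n) (hC1 n))
  refine hdense.mono fun x hx => ?_
  rw [mem_ofPred_eq, Subgroup.eq_bot_iff_forall]
  intro g hg
  by_contra hne
  obtain ⟨n, hn⟩ := mem_iUnion.1 ((iUnion_compactCovering ({1}ᶜ : Set G)) ▸
    mem_univ (⟨g, hne⟩ : ({1}ᶜ : Set G)))
  exact eq_empty_iff_forall_notMem.1 (mem_iInter.1 hx n) g ⟨hg, _, hn, rfl⟩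

end TopologicallyFree

/-! ### The equivalence -/

theorem mainTheorem12 (G : Type u) [Group G] [TopologicalSpace G] [IsTopologicalGroup G]
    [LocallyCompactSpace G] [T2Space G] [SecondCountableTopology G] :
    (∃ (X : Type u) (_ : TopologicalSpace X) (_ : MeasurableSpace X) (_ : BorelSpace X)
        (_ : MulAction G X) (_ : ContinuousSMul G X),
        IsGBoundary G X ∧ IsTopologicallyFree G X) ↔
      ∀ H : ClosedSubgroup G, H.IsRelativelyAmenable → ¬ H.IsConfined := by
  constructor
  · rintro ⟨X, _, _, _, _, _, hX, hfree⟩ H hH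
    exact not_isConfined_of_isTopologicallyFree hX hfree H hH
  · intro h
    obtain ⟨X, _, _, _, _, _, ι, hX, hι⟩ := exists_isGBoundary (E := uniformFunctions G)
      (ρ := uniformTranslation G) (u := uniformOne G) (P := uniformNonneg G)
      norm_smul_uniformOne_sub_mem (fun g => by ext x; simp) (fun g f hf x => hf (g⁻¹ * x))
      continuous_uniformTranslation stateSet_uniformFunctions_nonempty
    refine ⟨X, inferInstance, inferInstance, inferInstance, inferInstance, inferInstance, hX, ?_⟩
    have := hX.compact
    have := hX.hausdorff
    have := hX.minimal
    obtain ⟨y⟩ := hX.nonempty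
    let H : ClosedSubgroup G := ⟨MulAction.stabilizer G y,
      isClosed_eq (by fun_prop : Continuous fun g : G => g • y) continuous_const⟩
    have hH : ∀ g, g ∈ H ↔ g • y = y := fun g => Iff.rfl
    have hamen : H.IsRelativelyAmenable := isRelativelyAmenable_of_fixes_state (hι y).1
      fun g hg => by rw [← (hι y).2, (hH g).1 hg]
    have hconf := h H hamen
    rw [ClosedSubgroup.isConfined_iff] at hconf
    push Not at hconf
    -- The stabilizer of `g • y` is the conjugate of `H` by `g`.
    refine isTopologicallyFree_of_forall_compact (y := y) fun K hK h1 => ?_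
    obtain ⟨g, hg⟩ := hconf K hK h1
    refine ⟨g, ?_⟩
    rw [← hg]
    congr 1
    ext x
    rw [ClosedSubgroup.mem_conj_iff, hH, mul_smul, mul_smul, inv_smul_eq_iff]
    rfl
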